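/- Let $D$ be a skew field that is finite-dimensional over its center $C(D)$, and let $\sigma$ be an automorphism of $D$ of finite order modulo inner automorphisms, that is, there are an integer $\nu \ge 1$ and $u \in D\setminus\{0\}$ with $\sigma^\nu(a) = u a u^{-1}$ for all $a \in D$. Let $R = D[X;\sigma]$ be the skew polynomial ring of left polynomials $\sum_n a_n X^n$ with $a_n\in D$ and the product determined by $Xa = \sigma(a)X$ for $a \in D$, and let $C$ be the center of $R$. A bound $f^*$ of $f \in R$ is an element of $R$ such that $Rf^* = f^*R$ and this is the largest twosided ideal of $R$ contained in $Rf$. Let $\deg$ denote the degree in $X$, with $\deg 0 = -\infty$. Then $R$ is a free $C$-module of finite rank $r$; every $f \in R$ has a bound; and for every $f \in R$ and every bound $f^*$ of $f$ one has $f^* \neq 0$ if $f \neq 0$, and $$\deg f^* \le \sqrt{r}\,\deg f .$$ -/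

import Mathlib

namespace SkewPolynomial

/-- The degree (in `X`) of a left skew polynomial `∑ aₙ Xⁿ`, with `deg 0 = -∞`. It takes values in
the extended reals, so that it can be compared with real multiples of other degrees. -/
noncomputable def deg {D : Type*} [Semiring D] (f : SkewPolynomial D) : EReal :=
  f.support.sup fun n : ℕ => (n : EReal)

end SkewPolynomial

/-- `b` is a bound of `f`: one has `R b = b R`, and this is the largest twosided ideal
contained in the left ideal `R f`. (In Mathlib `Ideal R` is the type of left ideals, and
`Ideal.span {f}` is `R f`.) -/
structure IsBoundOf {R : Type*} [Ring R] (b f : R) : Prop where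
  twosided : (Ideal.span {b} : Set R) = Set.range (fun g : R => b * g)
  isGreatest : IsGreatest {I : Ideal R | I.IsTwoSided ∧ I ≤ Ideal.span {f}} (Ideal.span {b})

/-! Let `F` be the subfield of the center of `D` fixed by `σ`. By Artin's theorem `D` is finite over
`F`. A power of `σ` being inner yields a central monomial of positive degree. If `T = u X^k` is one
of minimal degree, the center is `C = F[T]`. This is a principal ideal domain over which the domain
`R` is finite and torsion-free, hence free.

Division with remainder makes left ideals principal, so the largest twosided ideal inside `R f` has
a generator `b`. If `z ≠ 0` is central and lies in `R f`, then `R z` is twosided, so `z = a b` and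
`deg b ≤ deg z`. It remains to find `z` with `deg z ≤ √r deg f`.

The commutative ring `S = C[f]` has rank `s` over `C` with `s² ≤ r`
(`Subalgebra.finrank_sq_le_finrank`). Put `e = deg f` and let `N m` be the elements of `S` of degree
below `m`. Raising `m` by `k` adds at most `s` to `dim_F N m`. If no nonzero central multiple of `f`
had degree at most `e s`, then for large `m` the space `N (m + e)` would contain the direct sum of
`f N m` and the central elements of degree at most `e s`. That growth is too fast
(`exists_mul_eq_algebraMap_of_filtration`). -/

open Polynomial

/-! ### Central multiples and generalized identities -/

section CentralMultiples

variable {C R : Type*} [CommRing C] [IsDomain C] [Ring R] [IsDomain R] [Algebra C R]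

/-- In a domain, a nonzero element which is integral over a central subring divides a nonzero
element of that subring. -/
theorem IsIntegral.exists_mul_eq_algebraMap {a : R} (ha : a ≠ 0) (h : IsIntegral C a) :
    ∃ (a' : R) (c : C), c ≠ 0 ∧ a * a' = algebraMap C R c := by
  obtain ⟨p, hp, hpa⟩ := h
  have hpa' : aeval a p = 0 := hpa
  -- Cancelling the powers of `X` leaves an equation for `a` with nonzero constant term, which is
  -- then a multiple of `a`.
  obtain ⟨q, hq, hq'⟩ := exists_eq_pow_rootMultiplicity_mul_and_not_dvd p hp.ne_zero 0
  rw [C_0, sub_zero] at hq hq'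
  rw [hq, map_mul, map_pow, aeval_X] at hpa'
  have hqa : aeval a q = 0 := by
    rcases mul_eq_zero.1 hpa' with h | h
    · exact absurd h (pow_ne_zero _ ha)
    · exact h
  have hq0 : q.coeff 0 ≠ 0 := fun h => hq' (X_dvd_iff.2 h)
  have key : a * aeval a q.divX + algebraMap C R (q.coeff 0) = 0 := by
    have := congrArg (aeval a) (divX_mul_X_add q)
    rwa [mul_comm, map_add, map_mul, aeval_X, aeval_C, hqa] at this
  refine ⟨-aeval a q.divX, q.coeff 0, hq0, ?_⟩
  rw [mul_neg]
  exact neg_eq_of_add_eq_zero_right key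

/-- Two-sided independence over the center: elements `l i` independent over the center satisfy no
nontrivial generalized identity `∑ l i * q * a i = 0`. -/
theorem LinearIndependent.eq_zero_of_forall_sum_mul_mul_eq_zero [Module.Finite C R]
    [Module.IsTorsionFree C R] {ι : Type*} [Fintype ι]
    (hc : ∀ z ∈ Subring.center R, z ∈ Set.range (algebraMap C R))
    {l : ι → R} (hl : LinearIndependent C l) (a : ι → R)
    (ha : ∀ q, ∑ i, l i * q * a i = 0) : a = 0 := by
  classical
  induction hn : (Finset.univ.filter fun i => a i ≠ 0).card using Nat.strong_induction_on
    generalizing a with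
  | _ n ih =>
    by_contra hne
    obtain ⟨i₀, hi₀⟩ := Function.ne_iff.1 hne
    obtain ⟨a', c, hc0, hac⟩ := (IsIntegral.of_finite C (a i₀)).exists_mul_eq_algebraMap hi₀
    have hb : ∀ q, ∑ i, l i * q * (a i * a') = 0 := fun q => by
      simp_rw [← mul_assoc, ← Finset.sum_mul, ha q, zero_mul]
    -- The coefficient at `i₀` is now central, so commutators with `x` give an identity with fewer
    -- nonzero coefficients. By induction all `a i * a'` are central, and ordinary independence
    -- applies.
    have hcomm : ∀ x, (fun i => (a i * a') * x - x * (a i * a')) = 0 := by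
      intro x
      refine ih _ ?_ _ ?_ rfl
      · rw [← hn]
        apply Finset.card_lt_card
        rw [Finset.ssubset_iff_of_subset]
        · refine ⟨i₀, by simpa using hi₀, ?_⟩
          simp [hac, Algebra.commutes]
        · intro i
          simp only [Finset.mem_filter, Finset.mem_univ, true_and]
          intro h h0
          simp [h0] at h
      · intro q
        have h1 := hb q
        have h2 := hb (q * x)
        have : ∑ i, l i * q * ((a i * a') * x - x * (a i * a'))
            = (∑ i, l i * q * (a i * a')) * x - ∑ i, l i * (q * x) * (a i * a') := by
          rw [Finset.sum_mul, ← Finset.sum_sub_distrib]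
          refine Finset.sum_congr rfl fun i _ => ?_
          noncomm_ring
        rw [this, h1, h2, zero_mul, sub_zero]
    have hcen : ∀ i, ∃ d, algebraMap C R d = a i * a' := by
      intro i
      apply hc
      rw [Subring.mem_center_iff]
      intro x
      have := congrFun (hcomm x) i
      simp only [Pi.zero_apply] at this
      exact (sub_eq_zero.1 this).symm
    choose d hd using hcen
    have h1 := hb 1
    have h2 : ∑ i, d i • l i = 0 := by
      rw [← h1]
      refine Finset.sum_congr rfl fun i _ => ?_
      rw [← hd, mul_one, Algebra.smul_def, Algebra.commutes]
    have h3 := Fintype.linearIndependent_iff.1 hl d h2 i₀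
    have h4 := hd i₀
    rw [h3, map_zero, hac] at h4
    exact hc0 ((FaithfulSMul.algebraMap_eq_zero_iff C R).1 h4.symm)

end CentralMultiples

/-! ### Rank of commutative subalgebras -/

section CommutativeSubalgebra

variable {C R : Type*} [CommRing C] [IsDomain C] [IsPrincipalIdealRing C] [Ring R] [IsDomain R]
  [Algebra C R] [Module.Finite C R] [Module.IsTorsionFree C R]

/-- A commutative subalgebra of a domain of rank `r` over its center has rank at most `√r`. -/
theorem Subalgebra.finrank_sq_le_finrank
    (hc : ∀ z ∈ Subring.center R, z ∈ Set.range (algebraMap C R))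
    (S : Subalgebra C R) (hS : ∀ x ∈ S, ∀ y ∈ S, x * y = y * x) :
    Module.finrank C S ^ 2 ≤ Module.finrank C R := by
  classical
  have : Module.Free C R := Module.free_of_finite_type_torsion_free'
  let _ : CommRing S :=
    { (inferInstance : Ring S) with
      mul_comm := fun x y => Subtype.ext (hS x x.2 y y.2) }
  have : Module.Finite C S := inferInstanceAs (Module.Finite C (Subalgebra.toSubmodule S))
  have : Module.Free C S := inferInstanceAs (Module.Free C (Subalgebra.toSubmodule S))
  let b := Module.finBasis C S
  -- The set `I` plays the role of a basis of `R` over the fraction field of `S`. Its size `t`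
  -- satisfies `s t ≤ r`, and the injection `Ψ : R^s → R^t` will give `s ≤ t`.
  obtain ⟨I, hI, hmax⟩ := exists_maximal_linearIndepOn S (id : R → R)
  have hI' : LinearIndependent S (fun q : I => (q : R)) := hI
  have hprod := linearIndependent_smul b.linearIndependent hI'
  have hfin : Finite (Fin (Module.finrank C S) × I) := hprod.finite
  have hpos : 0 < Module.finrank C S := Module.finrank_pos
  have : Nonempty (Fin (Module.finrank C S)) := ⟨⟨0, hpos⟩⟩
  have : Finite I := Finite.of_injective
    (fun q : I => (Classical.arbitrary (Fin (Module.finrank C S)), q))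
    (fun _ _ h => congrArg Prod.snd h)
  have := Fintype.ofFinite I
  have hcard : Module.finrank C S * Fintype.card I ≤ Module.finrank C R := by
    simpa using hprod.fintype_card_le_finrank
  let Ψ : (Fin (Module.finrank C S) → R) →ₗ[C] (I → R) :=
    LinearMap.pi fun q => ∑ j, (LinearMap.mulLeft C ((b j : R) * q)).comp (LinearMap.proj j)
  have hΨ : ∀ a q, Ψ a q = ∑ j, (b j : R) * q * a j := fun a q => by simp [Ψ, mul_assoc]
  have hinj : Function.Injective Ψ := by
    rw [injective_iff_map_eq_zero]
    intro a ha
    have hb : LinearIndependent C (fun j => (b j : R)) :=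
      b.linearIndependent.map' S.val.toLinearMap (LinearMap.ker_eq_bot.2 Subtype.val_injective)
    refine hb.eq_zero_of_forall_sum_mul_mul_eq_zero hc a fun q => ?_
    -- Since the `b j` commute with `S`, the sum is `S`-linear in `x`, so vanishing on `I` passes to
    -- its span. By maximality every `q` has a nonzero `S`-multiple in that span.
    have hspan : ∀ x ∈ Submodule.span S (id '' I), ∑ j, (b j : R) * x * a j = 0 := by
      intro x hx
      induction hx using Submodule.span_induction with
      | mem x hx =>
        rw [Set.image_id] at hx
        rw [← hΨ a ⟨x, hx⟩, ha, Pi.zero_apply]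
      | zero => simp
      | add x y _ _ hx hy => simp [mul_add, add_mul, Finset.sum_add_distrib, hx, hy]
      | smul s x _ hx =>
        have : ∑ j, (b j : R) * (s • x) * a j = s * ∑ j, (b j : R) * x * a j := by
          rw [Finset.mul_sum]
          refine Finset.sum_congr rfl fun j _ => ?_
          rw [Subalgebra.smul_def, smul_eq_mul, ← mul_assoc, hS _ (b j).2 _ s.2]
          simp only [mul_assoc]
        rw [this, hx, mul_zero]
    by_cases hq : q ∈ I
    · exact hspan q (Submodule.subset_span ⟨q, hq, rfl⟩)
    · obtain ⟨s, hs, hsq⟩ := hmax q hq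
      have := hspan _ hsq
      have h2 : ∑ j, (b j : R) * (s • id q) * a j = s * ∑ j, (b j : R) * q * a j := by
        rw [Finset.mul_sum]
        refine Finset.sum_congr rfl fun j _ => ?_
        rw [Subalgebra.smul_def, smul_eq_mul, ← mul_assoc, hS _ (b j).2 _ s.2]
        simp only [mul_assoc, id]
      rw [h2, mul_eq_zero] at this
      exact this.resolve_left fun h => hs (Subtype.ext h)
  have hle := LinearMap.finrank_le_finrank_of_injective hinj
  rw [Module.finrank_pi_fintype, Module.finrank_pi_fintype] at hle
  simp only [Finset.sum_const, Finset.card_univ, Fintype.card_fin, smul_eq_mul] at hle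
  have hle' := Nat.le_of_mul_le_mul_right hle Module.finrank_pos
  rw [sq]
  exact (Nat.mul_le_mul_left _ hle').trans hcard

end CommutativeSubalgebra

/-! ### Growth of a filtration -/

section Filtration

/-- If `N'` meets `X • M` in `X • N`, then `N'` is larger than `N` by at most the rank of `M`. -/
theorem finrank_le_finrank_add_of_forall_X_smul_mem {F M : Type*} [Field F] [AddCommGroup M]
    [Module F M] [Module F[X] M] [IsScalarTower F F[X] M] [Module.Finite F[X] M]
    [Module.Free F[X] M] (N N' : Submodule F M) [FiniteDimensional F N] [FiniteDimensional F N']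
    (h : ∀ x, (X : F[X]) • x ∈ N' ↔ x ∈ N) :
    Module.finrank F N' ≤ Module.finrank F N + Module.finrank F[X] M := by
  let b := Module.finBasis F[X] M
  -- Constant terms of the coordinates: the kernel of `π` is `X • M`, which meets `N'` in `X • N`.
  let π : M →ₗ[F] (Fin (Module.finrank F[X] M) → F) :=
    LinearMap.pi fun j => (lcoeff F 0).comp ((b.coord j).restrictScalars F)
  let μ : N →ₗ[F] N' :=
    ((LinearMap.lsmul F[X] M X).restrictScalars F).restrict fun x hx => (h _).2 hx
  have hker : LinearMap.ker (π.domRestrict N') ≤ LinearMap.range μ := by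
    intro x hx
    have hx' : ∀ j, X ∣ b.repr x j := fun j => X_dvd_iff.2 (congrFun hx j)
    choose c hc using hx'
    have hxy : (x : M) = (X : F[X]) • ∑ j, c j • b j := by
      rw [← b.sum_repr (x : M), Finset.smul_sum]
      refine Finset.sum_congr rfl fun j _ => ?_
      rw [hc, mul_smul]
    have hmem : (∑ j, c j • b j) ∈ N := by
      rw [← h, ← hxy]
      exact x.2
    exact ⟨⟨_, hmem⟩, Subtype.ext hxy.symm⟩
  have h1 := LinearMap.finrank_range_add_finrank_ker (π.domRestrict N')
  have h2 := (Submodule.finrank_mono hker).trans (LinearMap.finrank_range_le μ)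
  have h3 := Submodule.finrank_le (LinearMap.range (π.domRestrict N'))
  rw [Module.finrank_fin_fun] at h3
  omega

variable {F R : Type*} [Field F] [Ring R] [IsDomain R] [Algebra F R] [Algebra F[X] R]
  [IsScalarTower F F[X] R] [Module.Finite F[X] R] [Module.IsTorsionFree F[X] R]

/-- Let `R` be a domain, finite over its center `F[X]`, with a filtration `L` for which `X` has
degree `k` and `f` has degree at most `e`. Then `f` divides a nonzero central element of degree at
most `√r * e`, where `r` is the rank of `R` over its center. -/
theorem exists_mul_eq_algebraMap_of_filtration
    (hc : ∀ z ∈ Subring.center R, z ∈ Set.range (algebraMap F[X] R))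
    (L : ℕ → Submodule F R) [∀ m, FiniteDimensional F (L m)] {k : ℕ} (hk : 0 < k)
    (hL : ∀ m x, (X : F[X]) • x ∈ L (m + k) ↔ x ∈ L m)
    (hT : ∀ (p : F[X]) m, k * p.natDegree < m → algebraMap F[X] R p ∈ L m)
    {f : R} (hf0 : f ≠ 0) {e : ℕ} (hf : ∀ m, ∀ x ∈ L m, f * x ∈ L (m + e)) :
    ∃ p : F[X], p ≠ 0 ∧ (∃ g, g * f = algebraMap F[X] R p) ∧
      (k * p.natDegree) ^ 2 ≤ Module.finrank F[X] R * e ^ 2 := by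
  have : Module.Free F[X] R := Module.free_of_finite_type_torsion_free'
  obtain ⟨S, hS⟩ : ∃ S, S = Algebra.adjoin F[X] {f} := ⟨_, rfl⟩
  have hfS : f ∈ S := hS ▸ Algebra.self_mem_adjoin_singleton F[X] f
  have hSf : ∀ x ∈ S, f * x = x * f := fun x hx =>
    (Algebra.commute_of_mem_adjoin_singleton_of_commute (R := F[X]) (b := f) (by rwa [← hS]) (Commute.refl f)).eq
  have hcomm : ∀ x ∈ S, ∀ y ∈ S, x * y = y * x := fun x hx y hy =>
    Algebra.commute_of_mem_adjoin_of_forall_mem_commute (hS ▸ hy) fun z hz => by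
      rw [Set.mem_singleton_iff.1 hz]
      exact (hSf x hx).symm
  have hsq := S.finrank_sq_le_finrank hc hcomm
  have : Module.Finite F[X] S := inferInstanceAs (Module.Finite F[X] (Subalgebra.toSubmodule S))
  have : Module.Free F[X] S := inferInstanceAs (Module.Free F[X] (Subalgebra.toSubmodule S))
  set s := Module.finrank F[X] S
  let ι : S →ₗ[F] R := S.val.toLinearMap.restrictScalars F
  have hι : Function.Injective ι := Subtype.val_injective
  let N : ℕ → Submodule F S := fun m => (L m).comap ι
  have hN : ∀ m, FiniteDimensional F (N m) := fun m =>
    FiniteDimensional.of_injective (ι.restrict (p := N m) (q := L m) fun x hx => hx)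
      fun x y h => Subtype.ext (hι (congrArg (fun z : L m => (z : R)) h))
  by_contra! hcon
  have hupper : ∀ m, Module.finrank F (N (m + k)) ≤ Module.finrank F (N m) + s := by
    intro m
    exact finrank_le_finrank_add_of_forall_X_smul_mem (N m) (N (m + k)) fun x => hL m x
  -- The dimension of the space of `p` with `k * deg p ≤ e * s`.
  set d := e * s / k + 1 with hd
  -- The condition on `m` puts these central elements in `L (m + e)`. A nonzero one in `f * N m`
  -- would contradict `hcon`, because `s ^ 2` is at most the rank.
  have hlower : ∀ m, e * s < m → Module.finrank F (N m) + d ≤ Module.finrank F (N (m + e)) := by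
    intro m hm
    have hdeg : ∀ p ∈ degreeLT F d, k * p.natDegree ≤ e * s := by
      intro p hp
      rw [mem_degreeLT] at hp
      have h1 : p.natDegree ≤ e * s / k := by
        by_cases hp0 : p = 0
        · simp [hp0]
        · rw [degree_eq_natDegree hp0, Nat.cast_lt] at hp
          omega
      exact (Nat.mul_le_mul_left k h1).trans (Nat.mul_div_le _ _)
    let μ : N m × degreeLT F d →ₗ[F] N (m + e) :=
      LinearMap.coprod
        (((LinearMap.mulLeft F[X] (⟨f, hfS⟩ : S)).restrictScalars
          F).restrict fun x hx => hf m _ hx)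
        (((Algebra.linearMap F[X] S).restrictScalars F).restrict fun p hp =>
          hT p (m + e) (by have := hdeg p hp; omega))
    have hμ : Function.Injective μ := by
      rw [injective_iff_map_eq_zero]
      rintro ⟨x, p⟩ hxp
      have hxp' : f * (x : S) + algebraMap F[X] R p = 0 :=
        congrArg (fun y : N (m + e) => ((y : S) : R)) hxp
      by_cases hp : (p : F[X]) = 0
      · rw [hp, map_zero, add_zero, mul_eq_zero] at hxp'
        have hx : x = 0 := Subtype.ext (Subtype.ext (hxp'.resolve_left hf0))
        rw [hx, Subtype.ext (a1 := p) (a2 := 0) hp]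
        rfl
      · exfalso
        refine absurd (hcon p hp ⟨-((x : S) : R), ?_⟩) (not_lt.2 ?_)
        · rw [neg_mul, ← hSf _ x.1.2]
          exact neg_eq_of_add_eq_zero_right hxp'
        · calc (k * (p : F[X]).natDegree) ^ 2 ≤ (e * s) ^ 2 := Nat.pow_le_pow_left (hdeg p p.2) 2
            _ = s ^ 2 * e ^ 2 := by ring
            _ ≤ _ := Nat.mul_le_mul_right _ hsq
    have h1 := LinearMap.finrank_le_finrank_of_injective hμ
    have : Module.Free F (N m) := Module.Free.of_divisionRing F (N m)
    rwa [Module.finrank_prod, LinearEquiv.finrank_eq (degreeLTEquiv F d),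
      Module.finrank_fin_fun] at h1
  have hupper' : ∀ m j, Module.finrank F (N (m + k * j)) ≤ Module.finrank F (N m) + s * j := by
    intro m j
    induction j with
    | zero => simp
    | succ j ih =>
      have := hupper (m + k * j)
      rw [mul_add _ j, mul_one, mul_add _ j, mul_one, ← add_assoc m]
      omega
  have hlower' : ∀ m j, e * s < m →
      Module.finrank F (N m) + d * j ≤ Module.finrank F (N (m + e * j)) := by
    intro m j hm
    induction j with
    | zero => simp
    | succ j ih =>
      have := hlower (m + e * j) (by omega)
      rw [mul_add _ j, mul_one, mul_add _ j, mul_one, ← add_assoc m]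
      omega
  -- Both estimates are compared over a common shift `e * k`: they give `k * d ≤ e * s`, whereas `d`
  -- was chosen with `k * d > e * s`.
  have h1 := hupper' (e * s + 1) e
  have h2 := hlower' (e * s + 1) k (by omega)
  rw [mul_comm e k] at h2
  have h3 : e * s < k * d := Nat.lt_mul_div_succ (e * s) hk
  rw [mul_comm k d, mul_comm e s] at h3
  omega

end Filtration

/-! ### Coefficients, degrees and division with remainder -/

namespace SkewPolynomial

section Semiring

variable {D : Type*} [Semiring D]

theorem coeff_smul {S : Type*} [SMulZeroClass S D] (a : S) (f : SkewPolynomial D) (n : ℕ) :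
    (a • f).coeff n = a • f.coeff n := by
  simp [coeff]

variable (D) in
/-- The skew polynomials of degree less than `m`. -/
def degLT (F : Type*) [Semiring F] [Module F D] (m : ℕ) : Submodule F (SkewPolynomial D) where
  carrier := {f | ∀ n, m ≤ n → f.coeff n = 0}
  add_mem' hf hg n hn := by rw [coeff_add, hf n hn, hg n hn, add_zero]
  zero_mem' n _ := coeff_zero n
  smul_mem' a f hf n hn := by rw [coeff_smul, hf n hn, smul_zero]

theorem mem_degLT {F : Type*} [Semiring F] [Module F D] {m : ℕ} {f : SkewPolynomial D} :
    f ∈ degLT D F m ↔ ∀ n, m ≤ n → f.coeff n = 0 := Iff.rfl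

/-- The degree of a skew polynomial, with value `0` at `0`. -/
def natDegree (f : SkewPolynomial D) : ℕ := f.support.sup id

theorem coeff_eq_zero_of_natDegree_lt {f : SkewPolynomial D} {n : ℕ} (h : f.natDegree < n) :
    f.coeff n = 0 := by
  by_contra hne
  exact absurd (Finset.le_sup (f := id) (mem_support_iff.2 hne)) (not_le.2 h)

theorem coeff_natDegree_ne_zero {f : SkewPolynomial D} (hf : f ≠ 0) :
    f.coeff f.natDegree ≠ 0 := by
  obtain ⟨n, hn, h⟩ := Finset.exists_mem_eq_sup f.support
    (Finset.nonempty_iff_ne_empty.2 (mt support_eq_empty.1 hf)) id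
  rw [natDegree, h]
  exact mem_support_iff.1 hn

theorem le_natDegree_of_ne_zero {f : SkewPolynomial D} {n : ℕ} (h : f.coeff n ≠ 0) :
    n ≤ f.natDegree := Finset.le_sup (f := id) (mem_support_iff.2 h)

theorem natDegree_eq_of_coeff {f : SkewPolynomial D} {n : ℕ} (h : f.coeff n ≠ 0)
    (h' : ∀ i, n < i → f.coeff i = 0) : f.natDegree = n := by
  refine le_antisymm ?_ (le_natDegree_of_ne_zero h)
  by_contra hlt
  refine coeff_natDegree_ne_zero (f := f) ?_ (h' _ (not_le.1 hlt))
  rintro rfl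
  simp at h

theorem deg_eq_natDegree {f : SkewPolynomial D} (hf : f ≠ 0) : f.deg = (f.natDegree : EReal) := by
  refine le_antisymm (Finset.sup_le fun n hn => ?_) ?_
  · exact_mod_cast Finset.le_sup (f := id) hn
  · exact Finset.le_sup (f := fun n : ℕ => (n : EReal))
      (mem_support_iff.2 (coeff_natDegree_ne_zero hf))

theorem deg_zero : (0 : SkewPolynomial D).deg = ⊥ := by simp [deg]

theorem sum_monomial_coeff (f : SkewPolynomial D) :
    ∑ n ∈ f.support, monomial n (f.coeff n) = f := by
  rw [← sum_def f (fun n => monomial n), sum_monomial]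

theorem mem_degLT_iff_natDegree_lt {F : Type*} [Semiring F] [Module F D] {m : ℕ}
    {f : SkewPolynomial D} (hf : f ≠ 0) : f ∈ degLT D F m ↔ f.natDegree < m := by
  rw [mem_degLT]
  constructor
  · intro h
    by_contra hlt
    exact coeff_natDegree_ne_zero hf (h _ (not_lt.1 hlt))
  · exact fun h n hn => coeff_eq_zero_of_natDegree_lt (h.trans_le hn)

variable [MulSemiringAction (Multiplicative ℕ) D]

theorem coeff_mul (f g : SkewPolynomial D) (n : ℕ) :
    (f * g).coeff n = ∑ p ∈ Finset.HasAntidiagonal.antidiagonal n, f.coeff p.1 * φ^[p.1] (g.coeff p.2) := by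
  have h := SkewMonoidAlgebra.coeff_mul_antidiagonal_of_finset f g (Multiplicative.ofAdd n)
    ((Finset.HasAntidiagonal.antidiagonal n).map (Equiv.prodCongr Multiplicative.ofAdd
      Multiplicative.ofAdd).toEmbedding) (by
        rintro ⟨a, b⟩
        simp only [Finset.mem_map_equiv, Finset.HasAntidiagonal.mem_antidiagonal]
        rfl)
  rw [Finset.sum_map] at h
  refine h.trans (Finset.sum_congr rfl fun p _ => ?_)
  rw [φ_iterate_apply]
  rfl

theorem coeff_mul_monomial (f : SkewPolynomial D) (r n : ℕ) (a : D) :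
    (f * monomial r a).coeff (n + r) = f.coeff n * φ^[n] a := by
  rw [coeff_mul, Finset.sum_eq_single_of_mem (n, r) (by simp)]
  · simp [coeff_monomial]
  · rintro ⟨i, j⟩ hij hne
    rw [Finset.HasAntidiagonal.mem_antidiagonal] at hij
    have : r ≠ j := fun h => hne (by ext <;> simp at hij ⊢ <;> omega)
    simp [coeff_monomial, this, iterate_map_zero]

theorem coeff_monomial_mul (f : SkewPolynomial D) (r n : ℕ) (a : D) :
    (monomial r a * f).coeff (r + n) = a * φ^[r] (f.coeff n) := by
  rw [coeff_mul, Finset.sum_eq_single_of_mem (r, n) (by simp)]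
  · simp [coeff_monomial]
  · rintro ⟨i, j⟩ hij hne
    rw [Finset.HasAntidiagonal.mem_antidiagonal] at hij
    have : r ≠ i := fun h => hne (by ext <;> simp at hij ⊢ <;> omega)
    simp [coeff_monomial, this]

theorem coeff_mul_of_lt {f g : SkewPolynomial D} {a b n : ℕ} (hf : ∀ i, a < i → f.coeff i = 0)
    (hg : ∀ j, b < j → g.coeff j = 0) (hn : a + b < n) : (f * g).coeff n = 0 := by
  rw [coeff_mul]
  refine Finset.sum_eq_zero fun p hp => ?_
  rw [Finset.HasAntidiagonal.mem_antidiagonal] at hp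
  by_cases h : a < p.1
  · rw [hf _ h, zero_mul]
  · rw [hg _ (by omega), iterate_map_zero, mul_zero]

theorem coeff_mul_add {f g : SkewPolynomial D} {a b : ℕ} (hf : ∀ i, a < i → f.coeff i = 0)
    (hg : ∀ j, b < j → g.coeff j = 0) :
    (f * g).coeff (a + b) = f.coeff a * φ^[a] (g.coeff b) := by
  rw [coeff_mul, Finset.sum_eq_single_of_mem (a, b) (by simp)]
  rintro ⟨i, j⟩ hij hne
  rw [Finset.HasAntidiagonal.mem_antidiagonal] at hij
  by_cases h : a < i
  · simp [hf _ h]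
  · have : b < j := by
      by_contra h'
      exact hne (by ext <;> simp at hij ⊢ <;> omega)
    simp [hg _ this, iterate_map_zero]

/-- The center of a skew polynomial ring is a graded subring. -/
theorem mem_center_iff {f : SkewPolynomial D} :
    f ∈ Set.center (SkewPolynomial D) ↔
      ∀ n, (∀ d, d * f.coeff n = f.coeff n * φ^[n] d) ∧ φ (f.coeff n) = f.coeff n := by
  rw [Semigroup.mem_center_iff]
  constructor
  · intro h n
    constructor
    · intro d
      have h1 := coeff_monomial_mul f 0 n d
      have h2 := coeff_mul_monomial f 0 n d
      rw [h, zero_add] at h1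
      exact h1.symm.trans h2
    · have h1 := coeff_monomial_mul f 1 n 1
      have h2 := coeff_mul_monomial f 1 n 1
      rw [h, add_comm, h2, iterate_map_one] at h1
      simpa using h1.symm
  · intro h g
    ext n
    -- After the swap, the terms of `g * f` and `f * g` agree one by one, by the two conditions on
    -- the coefficients of `f`.
    rw [coeff_mul, coeff_mul, ← Finset.Nat.sum_antidiagonal_swap]
    refine Finset.sum_congr rfl fun p _ => ?_
    have hfix : ∀ i j, φ^[i] (f.coeff j) = f.coeff j := fun i j =>
      Function.iterate_fixed (h j).2 i
    simp only [Prod.fst_swap, Prod.snd_swap]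
    rw [hfix, (h p.1).1]

theorem monomial_mem_center_iff {n : ℕ} {a : D} :
    monomial n a ∈ Set.center (SkewPolynomial D) ↔ (∀ d, d * a = a * φ^[n] d) ∧ φ a = a := by
  rw [mem_center_iff]
  constructor
  · intro h
    simpa [coeff_monomial] using h n
  · intro h m
    by_cases hm : n = m
    · subst hm
      simpa [coeff_monomial] using h
    · simp [coeff_monomial, hm]

end Semiring

section DivisionRing

variable {D : Type*} [DivisionRing D] [MulSemiringAction (Multiplicative ℕ) D]

theorem φ_iterate_ne_zero {a : D} (n : ℕ) (h : a ≠ 0) : φ^[n] a ≠ 0 := by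
  rw [← iterate_map_zero (φ : D →+* D) n]
  exact fun h' => h (((φ : D →+* D).injective.iterate n) h')

theorem coeff_mul_natDegree_add_ne_zero {f g : SkewPolynomial D} (hf : f ≠ 0) (hg : g ≠ 0) :
    (f * g).coeff (f.natDegree + g.natDegree) ≠ 0 := by
  rw [coeff_mul_add (fun _ => coeff_eq_zero_of_natDegree_lt)
    (fun _ => coeff_eq_zero_of_natDegree_lt)]
  exact mul_ne_zero (coeff_natDegree_ne_zero hf)
    (φ_iterate_ne_zero _ (coeff_natDegree_ne_zero hg))

instance : NoZeroDivisors (SkewPolynomial D) where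
  eq_zero_or_eq_zero_of_mul_eq_zero {f g} h := by
    by_contra! hne
    exact coeff_mul_natDegree_add_ne_zero hne.1 hne.2 (by rw [h, coeff_zero])

instance : IsDomain (SkewPolynomial D) := NoZeroDivisors.to_isDomain _

theorem natDegree_mul {f g : SkewPolynomial D} (hf : f ≠ 0) (hg : g ≠ 0) :
    (f * g).natDegree = f.natDegree + g.natDegree :=
  natDegree_eq_of_coeff (coeff_mul_natDegree_add_ne_zero hf hg) fun _ hi =>
    coeff_mul_of_lt (fun _ => coeff_eq_zero_of_natDegree_lt)
      (fun _ => coeff_eq_zero_of_natDegree_lt) hi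

instance finiteDimensional_degLT (F : Type*) [Field F] [Module F D] [Module.Finite F D] (m : ℕ) :
    FiniteDimensional F (degLT D F m) := by
  let c : degLT D F m →ₗ[F] (Fin m → D) :=
    { toFun := fun f i => (f : SkewPolynomial D).coeff i
      map_add' := fun f g => by ext i; simp
      map_smul' := fun a f => by ext i; simp [coeff_smul] }
  refine FiniteDimensional.of_injective c fun f g h => Subtype.ext ?_
  ext n
  by_cases hn : n < m
  · exact congrFun h ⟨n, hn⟩
  · rw [f.2 n (not_lt.1 hn), g.2 n (not_lt.1 hn)]

/-- Right division with remainder. -/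
theorem exists_sub_mul_natDegree_lt {f : SkewPolynomial D} (hf : f ≠ 0) (g : SkewPolynomial D) :
    ∃ q, g - q * f = 0 ∨ (g - q * f).natDegree < f.natDegree := by
  induction hn : g.natDegree using Nat.strong_induction_on generalizing g with
  | _ n ih =>
    by_cases hg : g = 0
    · exact ⟨0, Or.inl (by simp [hg])⟩
    by_cases hlt : g.natDegree < f.natDegree
    · exact ⟨0, Or.inr (by simpa using hlt)⟩
    obtain ⟨m, hm⟩ := Nat.exists_eq_add_of_le (not_lt.1 hlt)
    have hlc := φ_iterate_ne_zero m (coeff_natDegree_ne_zero hf)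
    -- Chosen so that `q * f` has the leading term of `g`. The inverse is twisted because moving `X
    -- ^ m` past a coefficient applies `φ^[m]`.
    let q := monomial m (g.coeff g.natDegree * (φ^[m] (f.coeff f.natDegree))⁻¹)
    by_cases h0 : g - q * f = 0
    · exact ⟨q, Or.inl h0⟩
    have hle : ∀ i, g.natDegree ≤ i → (g - q * f).coeff i = 0 := by
      intro i hi
      obtain ⟨j, rfl⟩ := Nat.exists_eq_add_of_le hi
      rw [coeff_sub]
      have h1 := coeff_monomial_mul f m (f.natDegree + j)
        (g.coeff g.natDegree * (φ^[m] (f.coeff f.natDegree))⁻¹)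
      have h2 : g.natDegree + j = m + (f.natDegree + j) := by omega
      have h3 : (q * f).coeff (g.natDegree + j) = g.coeff g.natDegree *
          (φ^[m] (f.coeff f.natDegree))⁻¹ * φ^[m] (f.coeff (f.natDegree + j)) := by
        rw [h2]; exact h1
      rw [h3]
      rcases Nat.eq_zero_or_pos j with rfl | hj
      · rw [add_zero, add_zero, inv_mul_cancel_right₀ hlc, sub_self]
      · rw [coeff_eq_zero_of_natDegree_lt (f := g) (n := g.natDegree + j) (by omega),
          coeff_eq_zero_of_natDegree_lt (f := f) (n := f.natDegree + j) (by omega), iterate_map_zero, mul_zero, sub_zero]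
    have hlt' : (g - q * f).natDegree < n := by
      rw [← hn]
      by_contra hcon
      exact coeff_natDegree_ne_zero h0 (hle _ (not_lt.1 hcon))
    obtain ⟨q', hq'⟩ := ih _ hlt' _ rfl
    refine ⟨q + q', ?_⟩
    rwa [add_mul, ← sub_sub]

/-- Left ideals of a skew polynomial ring over a division ring are principal. -/
theorem exists_eq_span_singleton (J : Ideal (SkewPolynomial D)) : ∃ b, J = Ideal.span {b} := by
  classical
  by_cases hJ : J = ⊥
  · exact ⟨0, by simp [hJ]⟩
  obtain ⟨x, hxJ, hx0⟩ := Submodule.exists_mem_ne_zero_of_ne_bot hJ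
  have hex : ∃ n, ∃ b ∈ J, b ≠ 0 ∧ b.natDegree = n := ⟨_, x, hxJ, hx0, rfl⟩
  obtain ⟨b, hbJ, hb0, hb⟩ := Nat.find_spec hex
  refine ⟨b, le_antisymm (fun g hg => ?_) ((Ideal.span_singleton_le_iff_mem _).2 hbJ)⟩
  obtain ⟨q, hq⟩ := exists_sub_mul_natDegree_lt hb0 g
  rw [Ideal.mem_span_singleton']
  rcases hq with hq | hq
  · exact ⟨q, (sub_eq_zero.1 hq).symm⟩
  · by_contra hne
    rw [hb] at hq
    refine Nat.find_min hex hq ⟨_, J.sub_mem hg (J.mul_mem_left q hbJ), ?_, rfl⟩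
    exact fun h => hne ⟨q, (sub_eq_zero.1 h).symm⟩

end DivisionRing

end SkewPolynomial

/-! ### The center as a polynomial ring -/

namespace SkewPolynomial

section Center

variable {D : Type*} [DivisionRing D] [MulSemiringAction (Multiplicative ℕ) D]

theorem mul_mem_degLT {F : Type*} [Semiring F] [Module F D] {m : ℕ} (f : SkewPolynomial D)
    {x : SkewPolynomial D} (hx : x ∈ degLT D F m) : f * x ∈ degLT D F (m + f.natDegree) := by
  by_cases hx0 : x = 0
  · simp [hx0]
  by_cases hf0 : f = 0
  · simp [hf0]
  rw [mem_degLT_iff_natDegree_lt (mul_ne_zero hf0 hx0), natDegree_mul hf0 hx0]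
  have := (mem_degLT_iff_natDegree_lt hx0).1 hx
  omega

theorem monomial_mul_mem_degLT_iff {F : Type*} [Semiring F] [Module F D] {k m : ℕ} {u : D}
    (hu : u ≠ 0) {x : SkewPolynomial D} :
    monomial k u * x ∈ degLT D F (m + k) ↔ x ∈ degLT D F m := by
  simp only [mem_degLT]
  constructor
  · intro h n hn
    have := h (k + n) (by omega)
    rw [coeff_monomial_mul] at this
    by_contra hne
    exact mul_ne_zero hu (φ_iterate_ne_zero k hne) this
  · intro h n hn
    obtain ⟨j, rfl⟩ := Nat.exists_eq_add_of_le (show k ≤ n by omega)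
    rw [coeff_monomial_mul, h j (by omega), iterate_map_zero, mul_zero]

/-- The coefficient is a product of twists of `u`; only its being nonzero matters later. -/
theorem exists_monomial_pow_eq {k : ℕ} {u : D} (hu : u ≠ 0) (i : ℕ) :
    ∃ w : D, w ≠ 0 ∧ (monomial k u : SkewPolynomial D) ^ i = monomial (k * i) w := by
  induction i with
  | zero => exact ⟨1, one_ne_zero, rfl⟩
  | succ i ih =>
    obtain ⟨w, hw, h⟩ := ih
    refine ⟨w * φ^[k * i] u, mul_ne_zero hw (φ_iterate_ne_zero _ hu), ?_⟩
    rw [pow_succ, h, monomial_mul_monomial, mul_add, mul_one]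

/-- The coefficient of `X ^ n` as an additive map. -/
def coeffAddHom (D : Type*) [Semiring D] (n : ℕ) : SkewPolynomial D →+ D where
  toFun f := f.coeff n
  map_zero' := coeff_zero n
  map_add' f g := coeff_add f g n

theorem mem_center_of_mul_mem_center {R : Type*} [Ring R] [NoZeroDivisors R] {z t : R}
    (ht : t ∈ Set.center R) (ht0 : t ≠ 0) (h : z * t ∈ Set.center R) : z ∈ Set.center R := by
  rw [Semigroup.mem_center_iff] at *
  intro g
  refine mul_right_cancel₀ ht0 ?_
  rw [mul_assoc, h, mul_assoc, mul_assoc, ht]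

variable {F : Type*} [Field F] [Algebra F D] [SMulCommClass (Multiplicative ℕ) F D]

theorem aeval_monomial_mem_degLT {k : ℕ} {u : D} (hu : u ≠ 0) (p : F[X]) {m : ℕ}
    (h : k * p.natDegree < m) : aeval (monomial k u : SkewPolynomial D) p ∈ degLT D F m := by
  rw [aeval_eq_sum_range]
  refine Submodule.sum_mem _ fun i hi => Submodule.smul_mem _ _ ?_
  obtain ⟨w, hw, hi'⟩ := exists_monomial_pow_eq (k := k) hu i
  rw [hi', mem_degLT]
  intro n hn
  rw [Finset.mem_range] at hi
  have := Nat.mul_le_mul_left k (Nat.le_of_lt_succ hi)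
  rw [coeff_monomial, if_neg (by omega)]

/-- As `k > 0`, distinct powers of the monomial have distinct degrees, so the leading term cannot
cancel. -/
theorem aeval_monomial_injective {k : ℕ} (hk : 0 < k) {u : D} (hu : u ≠ 0) :
    Function.Injective (aeval (monomial k u : SkewPolynomial D) : F[X] →ₐ[F] _) := by
  rw [injective_iff_map_eq_zero]
  intro p hp
  by_contra hp0
  rw [aeval_eq_sum_range] at hp
  have h1 := congrArg (coeffAddHom D (k * p.natDegree)) hp
  rw [map_sum, map_zero, Finset.sum_eq_single_of_mem p.natDegree (by simp)] at h1
  · obtain ⟨w, hw, hi⟩ := exists_monomial_pow_eq (k := k) hu p.natDegree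
    rw [hi] at h1
    simp only [coeffAddHom, AddMonoidHom.coe_mk, ZeroHom.coe_mk, coeff_smul, coeff_monomial,
      if_true, smul_eq_zero, hw, or_false] at h1
    exact hp0 (leadingCoeff_eq_zero.1 h1)
  · intro i _ hi
    obtain ⟨w, hw, hi'⟩ := exists_monomial_pow_eq (k := k) hu i
    have : k * i ≠ k * p.natDegree := fun h => hi (Nat.eq_of_mul_eq_mul_left hk h)
    simp [coeffAddHom, hi', coeff_smul, coeff_monomial, this]

/-- The center of a skew polynomial ring is generated over the central constants fixed by the
twist by a central monomial of minimal positive degree. -/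
theorem mem_range_aeval_of_mem_center
    (hF : ∀ a : D, (∀ d, d * a = a * d) → φ a = a → a ∈ Set.range (algebraMap F D))
    {k : ℕ} (hk : 0 < k) {u : D} (hu : u ≠ 0)
    (hc : monomial k u ∈ Set.center (SkewPolynomial D))
    (hmin : ∀ n, 0 < n → n < k → ∀ a, monomial n a ∈ Set.center (SkewPolynomial D) → a = 0)
    {z : SkewPolynomial D} (hz : z ∈ Set.center (SkewPolynomial D)) :
    z ∈ (aeval (monomial k u : SkewPolynomial D) : F[X] →ₐ[F] _).range := by
  rw [← sum_monomial_coeff z]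
  refine Subalgebra.sum_mem _ fun n hn => ?_
  have hzn : monomial n (z.coeff n) ∈ Set.center (SkewPolynomial D) :=
    monomial_mem_center_iff.2 (mem_center_iff.1 hz n)
  rw [mem_support_iff] at hn
  obtain ⟨w, hw, hw'⟩ := exists_monomial_pow_eq (k := k) hu (n / k)
  -- Dividing by a power of the central monomial leaves a central monomial of degree `n % k < k`. By
  -- minimality that degree is `0`, so `a` is a constant from `F`.
  let a := z.coeff n * (φ^[n % k] w)⁻¹
  have hprod : monomial n (z.coeff n) = monomial (n % k) a * monomial k u ^ (n / k) := by
    rw [hw', monomial_mul_monomial, Nat.mod_add_div,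
      inv_mul_cancel_right₀ (φ_iterate_ne_zero _ hw)]
  have ha0 : a ≠ 0 := mul_ne_zero hn (inv_ne_zero (φ_iterate_ne_zero _ hw))
  have ha : monomial (n % k) a ∈ Set.center (SkewPolynomial D) := by
    refine mem_center_of_mul_mem_center (t := monomial k u ^ (n / k)) ?_ ?_ (hprod ▸ hzn)
    · exact pow_mem (S := Submonoid.center (SkewPolynomial D)) hc _
    · exact pow_ne_zero _ ((monomial_eq_zero_iff _ _).not.2 hu)
  have hr : n % k = 0 := by
    by_contra hne
    exact ha0 (hmin _ (Nat.pos_of_ne_zero hne) (Nat.mod_lt _ hk) a ha)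
  rw [hr, monomial_mem_center_iff] at ha
  obtain ⟨c, hca⟩ := hF a ha.1 ha.2
  refine ⟨Polynomial.C c * Polynomial.X ^ (n / k), ?_⟩
  change aeval _ _ = _
  rw [map_mul, map_pow, aeval_X, aeval_C, hprod, hr, ← hca]
  rfl

/-- A skew polynomial ring is finite over the subring generated by a central monomial, as soon as
its coefficient ring is finite over the constants of this subring. -/
theorem finite_of_aeval_monomial [Module.Finite F D] [Algebra F[X] (SkewPolynomial D)]
    [IsScalarTower F F[X] (SkewPolynomial D)] {k : ℕ} (hk : 0 < k) {u : D} (hu : u ≠ 0)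
    (h : ∀ p : F[X], algebraMap F[X] (SkewPolynomial D) p = aeval (monomial k u) p) :
    Module.Finite F[X] (SkewPolynomial D) := by
  -- Polynomials of degree below `k` generate, as any exponent can be reduced modulo `k` by powers
  -- of the central monomial.
  obtain ⟨s, hs⟩ := (Submodule.fg_iff_finiteDimensional (degLT D F k)).2 inferInstance
  refine ⟨s, eq_top_iff.2 fun f _ => ?_⟩
  rw [← sum_monomial_coeff f]
  refine Submodule.sum_mem _ fun n _ => ?_
  obtain ⟨w, hw, hw'⟩ := exists_monomial_pow_eq (k := k) hu (n / k)
  have hprod : monomial n (f.coeff n) = (Polynomial.X ^ (n / k) : F[X]) •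
      (monomial (n % k) (f.coeff n * (φ^[n % k] w)⁻¹) : SkewPolynomial D) := by
    rw [Algebra.smul_def, Algebra.commutes, h, map_pow, aeval_X, hw', monomial_mul_monomial,
      Nat.mod_add_div, inv_mul_cancel_right₀ (φ_iterate_ne_zero _ hw)]
  rw [hprod]
  refine Submodule.smul_mem _ _ ?_
  have hmem : monomial (n % k) (f.coeff n * (φ^[n % k] w)⁻¹) ∈ degLT D F k := by
    intro i hi
    have := Nat.mod_lt n hk
    rw [coeff_monomial, if_neg (by omega)]
  rw [← hs] at hmem
  exact Submodule.span_le_restrictScalars F F[X] _ hmem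

/-- If the division ring `D` is finite over its central constants fixed by the twist and there is
a central monomial of positive degree, then the skew polynomial ring is free of finite rank `r` over
its center, and each `f` divides a nonzero central element of degree at most `√r * deg f`. -/
theorem free_finite_center_and_exists_mem_center [Module.Finite F D]
    (hF : ∀ a : D, (∀ d, d * a = a * d) → φ a = a → a ∈ Set.range (algebraMap F D))
    (hex : ∃ k, 0 < k ∧ ∃ u : D, u ≠ 0 ∧ monomial k u ∈ Set.center (SkewPolynomial D)) :
    Module.Free (Subring.center (SkewPolynomial D)) (SkewPolynomial D) ∧
    Module.Finite (Subring.center (SkewPolynomial D)) (SkewPolynomial D) ∧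
    ∀ f : SkewPolynomial D, f ≠ 0 → ∃ z ∈ Set.center (SkewPolynomial D), z ≠ 0 ∧
      z ∈ Ideal.span {f} ∧ z.natDegree ^ 2 ≤
        Module.finrank (Subring.center (SkewPolynomial D)) (SkewPolynomial D) *
          f.natDegree ^ 2 := by
  classical
  obtain ⟨hk, u, hu, hc⟩ := Nat.find_spec hex
  set k := Nat.find hex
  have hmin : ∀ n, 0 < n → n < k → ∀ a, monomial n a ∈ Set.center (SkewPolynomial D) → a = 0 := by
    intro n hn hnk a ha
    by_contra ha0
    exact Nat.find_min hex hnk ⟨hn, a, ha0, ha⟩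
  let τ : F[X] →ₐ[F] SkewPolynomial D := aeval (monomial k u : SkewPolynomial D)
  have hinj : Function.Injective τ := aeval_monomial_injective hk hu
  have hτ : ∀ p, τ p ∈ Subring.center (SkewPolynomial D) := by
    intro p
    rw [Subring.mem_center_iff]
    intro x
    induction p using Polynomial.induction_on' with
    | add p q hp hq => rw [map_add, mul_add, add_mul, hp, hq]
    | monomial n a =>
      change x * aeval _ _ = aeval _ _ * x
      have hpow := Semigroup.mem_center_iff.1
        (pow_mem (S := Submonoid.center (SkewPolynomial D)) hc n) x
      rw [aeval_monomial, Algebra.left_comm, hpow, mul_assoc]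
  have hsurj : ∀ z ∈ Subring.center (SkewPolynomial D), z ∈ Set.range τ := fun z hz =>
    mem_range_aeval_of_mem_center hF hk hu hc hmin hz
  let _ : Algebra F[X] (SkewPolynomial D) :=
    τ.toRingHom.toAlgebra' fun p x => ((Subring.mem_center_iff.1 (hτ p)) x).symm
  have halg : ∀ p : F[X], algebraMap F[X] (SkewPolynomial D) p = τ p := fun _ => rfl
  have : IsScalarTower F F[X] (SkewPolynomial D) :=
    IsScalarTower.of_algebraMap_eq fun a => (aeval_C (monomial k u) a).symm
  have hfin : Module.Finite F[X] (SkewPolynomial D) := finite_of_aeval_monomial hk hu halg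
  have htf : Module.IsTorsionFree F[X] (SkewPolynomial D) :=
    Module.isTorsionFree_iff_algebraMap_injective.2 hinj
  let ε : F[X] ≃+* Subring.center (SkewPolynomial D) :=
    RingEquiv.ofBijective (τ.toRingHom.codRestrict _ hτ)
      ⟨fun p q h => hinj (congrArg Subtype.val h), fun z =>
        (hsurj z z.2).imp fun p hp => Subtype.ext hp⟩
  have hrank : Module.finrank F[X] (SkewPolynomial D) =
      Module.finrank (Subring.center (SkewPolynomial D)) (SkewPolynomial D) :=
    Algebra.finrank_eq_of_equiv_equiv ε (RingEquiv.refl _) rfl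
  have hfin' : Module.Finite (Subring.center (SkewPolynomial D)) (SkewPolynomial D) := by
    obtain ⟨s, hs⟩ := hfin
    refine ⟨s, eq_top_iff.2 fun x _ => ?_⟩
    have hx : x ∈ Submodule.span F[X] (s : Set (SkewPolynomial D)) := hs ▸ Submodule.mem_top
    induction hx using Submodule.span_induction with
    | mem x hx => exact Submodule.subset_span hx
    | zero => exact Submodule.zero_mem _
    | add x y _ _ hx hy => exact Submodule.add_mem _ (hx trivial) (hy trivial)
    | smul p x _ hx => exact Submodule.smul_mem _ (ε p) (hx trivial)
  have : IsPrincipalIdealRing (Subring.center (SkewPolynomial D)) :=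
    IsPrincipalIdealRing.of_surjective ε.toRingHom ε.surjective
  have : Module.IsTorsionFree (Subring.center (SkewPolynomial D)) (SkewPolynomial D) :=
    Module.isTorsionFree_iff_algebraMap_injective.2 Subtype.val_injective
  refine ⟨Module.free_of_finite_type_torsion_free', hfin', fun f hf => ?_⟩
  obtain ⟨p, hp, ⟨g, hg⟩, hdeg⟩ := exists_mul_eq_algebraMap_of_filtration hsurj (degLT D F) hk
    (fun m x => by
      rw [Algebra.smul_def, halg, show τ Polynomial.X = monomial k u from aeval_X _]
      exact monomial_mul_mem_degLT_iff hu)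
    (fun p m h => aeval_monomial_mem_degLT hu p h) hf (fun m x hx => mul_mem_degLT f hx)
  have hp0 : τ p ≠ 0 := fun h => hp (hinj (h.trans (map_zero τ).symm))
  refine ⟨τ p, hτ p, hp0, Ideal.mem_span_singleton'.2 ⟨g, hg⟩, ?_⟩
  have hle : (τ p).natDegree ≤ k * p.natDegree :=
    Nat.le_of_lt_succ ((mem_degLT_iff_natDegree_lt hp0).1
      (aeval_monomial_mem_degLT (F := F) hu p (Nat.lt_succ_self _)))
  rw [← hrank]
  exact (Nat.pow_le_pow_left hle 2).trans hdeg

end Center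

/-! ### Existence of bounds -/

section Bound

variable {D : Type*} [DivisionRing D] [MulSemiringAction (Multiplicative ℕ) D]

/-- If `b` generates a two-sided ideal as a left ideal, then also as a right ideal. -/
theorem span_singleton_eq_range_mul_left (F : Type*) [Field F] [Algebra F D]
    [SMulCommClass (Multiplicative ℕ) F D] [Module.Finite F D] {b : SkewPolynomial D}
    (hb : (Ideal.span {b}).IsTwoSided) :
    (Ideal.span {b} : Set (SkewPolynomial D)) = Set.range (fun g => b * g) := by
  ext x
  constructor
  · intro hx
    obtain ⟨a, rfl⟩ := Ideal.mem_span_singleton'.1 hx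
    by_cases hb0 : b = 0
    · exact ⟨0, by simp [hb0]⟩
    let m := a.natDegree + 1
    have hl : Function.Injective (LinearMap.mulLeft F b) := fun x y h =>
      mul_left_cancel₀ hb0 h
    have hr : Function.Injective (LinearMap.mulRight F b) := fun x y h =>
      mul_right_cancel₀ hb0 h
    -- Twosidedness gives `b R ⊆ R b`. In each bounded degree both sides have the same finite
    -- dimension over `F`, so the inclusion is an equality.
    have hle : (degLT D F m).map (LinearMap.mulLeft F b) ≤
        (degLT D F m).map (LinearMap.mulRight F b) := by
      rintro _ ⟨y, hy, rfl⟩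
      obtain ⟨c, hcb⟩ := Ideal.mem_span_singleton'.1
        (Ideal.IsTwoSided.mul_mem_of_left y (Ideal.mem_span_singleton_self b))
      refine ⟨c, ?_, hcb⟩
      by_cases hy0 : y = 0
      · have : c * b = 0 := by rw [hcb, hy0, mul_zero]
        rw [(mul_eq_zero.1 this).resolve_right hb0]
        exact Submodule.zero_mem _
      have hc0 : c ≠ 0 := by
        rintro rfl
        rw [zero_mul] at hcb
        exact mul_ne_zero hb0 hy0 hcb.symm
      have hdeg := congrArg natDegree hcb
      rw [natDegree_mul hc0 hb0, natDegree_mul hb0 hy0] at hdeg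
      refine (mem_degLT_iff_natDegree_lt hc0).2 ?_
      have := (mem_degLT_iff_natDegree_lt hy0).1 hy
      omega
    have heq := Submodule.eq_of_le_of_finrank_eq hle
      ((LinearEquiv.finrank_eq (Submodule.equivMapOfInjective _ hl (degLT D F m))).symm.trans
        (LinearEquiv.finrank_eq (Submodule.equivMapOfInjective _ hr (degLT D F m))))
    have ha : a ∈ degLT D F m := fun n hn => coeff_eq_zero_of_natDegree_lt hn
    have hab : a * b ∈ (degLT D F m).map (LinearMap.mulRight F b) := ⟨a, ha, rfl⟩
    rw [← heq] at hab
    obtain ⟨y, -, hy⟩ := hab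
    exact ⟨y, hy⟩
  · rintro ⟨g, rfl⟩
    exact Ideal.IsTwoSided.mul_mem_of_left g (Ideal.mem_span_singleton_self b)

/-- The largest two-sided ideal contained in a left ideal. -/
theorem _root_.Ideal.exists_isGreatest_isTwoSided {R : Type*} [Ring R] (I : Ideal R) :
    ∃ J, IsGreatest {K : Ideal R | K.IsTwoSided ∧ K ≤ I} J := by
  refine ⟨{ carrier := {x | ∀ y, x * y ∈ I}
            add_mem' := fun hx hy z => by rw [add_mul]; exact I.add_mem (hx z) (hy z)
            zero_mem' := fun z => by simp
            smul_mem' := fun c x hx z => by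
              rw [smul_eq_mul, mul_assoc]; exact I.mul_mem_left c (hx z) }, ⟨⟨?_⟩, ?_⟩, ?_⟩
  · intro a b ha y
    rw [mul_assoc]
    exact ha (b * y)
  · intro x hx
    simpa using hx 1
  · rintro K ⟨hK, hKI⟩ x hx y
    exact hKI (hK.mul_mem_of_left y hx)

theorem exists_isBoundOf (F : Type*) [Field F] [Algebra F D]
    [SMulCommClass (Multiplicative ℕ) F D] [Module.Finite F D] (f : SkewPolynomial D) :
    ∃ b, IsBoundOf b f := by
  obtain ⟨J, hJ⟩ := (Ideal.span {f}).exists_isGreatest_isTwoSided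
  obtain ⟨b, rfl⟩ := exists_eq_span_singleton J
  exact ⟨b, span_singleton_eq_range_mul_left F hJ.1.1, hJ⟩

/-- A central left multiple of `f` is a left multiple of each bound of `f`. -/
theorem _root_.IsBoundOf.mem_span_of_mem_center {R : Type*} [Ring R] {b f z : R}
    (h : IsBoundOf b f) (hz : z ∈ Set.center R) (hzf : z ∈ Ideal.span {f}) :
    z ∈ Ideal.span {b} := by
  refine h.isGreatest.2 ⟨⟨fun {x} y hx => ?_⟩, ?_⟩ (Ideal.mem_span_singleton_self z)
  · obtain ⟨a, rfl⟩ := Ideal.mem_span_singleton'.1 hx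
    refine Ideal.mem_span_singleton'.2 ⟨a * y, ?_⟩
    rw [mul_assoc, mul_assoc, Semigroup.mem_center_iff.1 hz y]
  · exact (Ideal.span_singleton_le_iff_mem _).2 hzf

end Bound

/-! ### A central monomial from an inner power -/

section FiniteOrder

variable {D : Type*} [DivisionRing D] [MulSemiringAction (Multiplicative ℕ) D]

/-- If some power of the twist is inner, there is a central monomial of positive degree. -/
theorem exists_monomial_mem_center (hφ : Function.Surjective (φ : D →+* D)) {ν : ℕ} (hν : 0 < ν)
    {u : D} (hu : u ≠ 0) (h : ∀ a : D, φ^[ν] a = u * a * u⁻¹) :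
    ∃ k, 0 < k ∧ ∃ w : D, w ≠ 0 ∧ monomial k w ∈ Set.center (SkewPolynomial D) := by
  have hu' : ∀ d, u * d = φ^[ν] d * u := fun d => by rw [h, inv_mul_cancel_right₀ hu]
  have hfix : φ^[ν] u = u := by rw [h, mul_inv_cancel_right₀ hu]
  have hcomm : ∀ i (a : D), φ^[ν] (φ^[i] a) = φ^[i] (φ^[ν] a) := fun i a => by
    rw [← Function.iterate_add_apply, add_comm, Function.iterate_add_apply]
  have hinner : ∀ i d, φ^[i] u * d = φ^[ν] d * φ^[i] u := by
    intro i d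
    obtain ⟨d, rfl⟩ := hφ.iterate i d
    rw [hcomm, ← iterate_map_mul, hu', iterate_map_mul]
  -- The element `u` need not be fixed by `φ`, but the norm-like product `V ν = u φ(u) ⋯ φ^[ν-1](u)`
  -- is, because `φ^[ν] u = u`. Each factor induces `φ^[ν]` by conjugation, so `V ν` induces `φ^[ν *
  -- ν]`.
  let V : ℕ → D := fun n => Nat.rec 1 (fun i v => v * φ^[i] u) n
  have hV : ∀ n, V (n + 1) = V n * φ^[n] u := fun n => rfl
  have hV0 : ∀ n, V n ≠ 0 := by
    intro n
    induction n with
    | zero => exact one_ne_zero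
    | succ n ih => exact mul_ne_zero ih (φ_iterate_ne_zero _ hu)
  have hVfix : ∀ n, φ^[ν] (V n) = V n := by
    intro n
    induction n with
    | zero => exact iterate_map_one _ _
    | succ n ih => rw [hV, iterate_map_mul, ih, hcomm, hfix]
  have hVinner : ∀ n d, V n * d = φ^[ν * n] d * V n := by
    intro n
    induction n with
    | zero => intro d; simp [V]
    | succ n ih =>
      intro d
      rw [hV, mul_assoc, hinner, ← mul_assoc, ih, ← Function.iterate_add_apply, mul_assoc,
        mul_add, mul_one]
  have hVφ : ∀ n, u * φ (V n) = V (n + 1) := by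
    intro n
    induction n with
    | zero => simp [V]
    | succ n ih =>
      rw [hV n, map_mul, ← mul_assoc, ih, hV (n + 1), Function.iterate_succ_apply']
  have hφV : φ (V ν) = V ν := by
    refine mul_left_cancel₀ hu ?_
    rw [hVφ, hV, hfix, hu', hVfix]
  refine ⟨ν * ν, Nat.mul_pos hν hν, (V ν)⁻¹, inv_ne_zero (hV0 ν), monomial_mem_center_iff.2
    ⟨fun d => ?_, ?_⟩⟩
  · rw [mul_inv_eq_iff_eq_mul₀ (hV0 ν), mul_assoc, ← hVinner, inv_mul_cancel_left₀ (hV0 ν)]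
  · rw [map_inv₀, hφV]

end FiniteOrder

end SkewPolynomial

/-! ### The fixed field and the final estimate -/

/-- A division ring which is finite over its center is finite over the fixed field in the center of
an automorphism of which some power is inner. -/
theorem exists_field_finite_algebraMap_range_eq {D : Type*} [DivisionRing D]
    (hD : Module.Finite (Subring.center D) D) (σ : D ≃+* D) {ν : ℕ} (hν : 0 < ν)
    {u : D} (hu : u ≠ 0) (h : ∀ a : D, (σ^[ν]) a = u * a * u⁻¹) :
    ∃ F : Subfield (Subring.center D), Module.Finite F D ∧
      ∀ a : Subring.center D, a ∈ F ↔ σ a = a := by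
  let τ : RingAut (Subring.center D) := Subring.centerCongr σ
  have hτ : ∀ (n : ℕ) (a : Subring.center D), ((τ ^ n) a : D) = σ^[n] a := by
    intro n
    induction n with
    | zero => intro a; rfl
    | succ n ih =>
      intro a
      rw [pow_succ', Function.iterate_succ_apply', ← ih]
      rfl
  -- Inner automorphisms are trivial on the center, so `σ` acts there through a finite group and
  -- Artin's theorem applies.
  have hτν : τ ^ ν = 1 := by
    refine RingEquiv.ext fun a => Subtype.ext ?_
    rw [hτ, h, Subring.mem_center_iff.1 a.2 u, mul_inv_cancel_right₀ hu]
    rfl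
  have hfin : Finite (Subgroup.zpowers τ) :=
    finite_zpowers.2 (isOfFinOrder_iff_pow_eq_one.2 ⟨ν, hν, hτν⟩)
  refine ⟨FixedPoints.subfield (Subgroup.zpowers τ) (Subring.center D),
    Module.Finite.trans (Subring.center D) D, fun a => ⟨fun ha => ?_, fun ha g => ?_⟩⟩
  · exact congrArg Subtype.val (ha ⟨τ, Subgroup.mem_zpowers τ⟩)
  · have hmem : (g : RingAut (Subring.center D)) ∈
        MulAction.stabilizer (RingAut (Subring.center D)) a :=
      (Subgroup.zpowers_le (H := MulAction.stabilizer (RingAut (Subring.center D)) a)).2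
        (Subtype.ext ha) g.2
    exact hmem

theorem corollary3p9 {D : Type*} [DivisionRing D]
    (hD : Module.Finite (Subring.center D) D)
    (σ : D ≃+* D)
    (hσ : ∃ ν : ℕ, 0 < ν ∧ ∃ u : D, u ≠ 0 ∧ ∀ a : D, (σ^[ν]) a = u * a * u⁻¹)
    [MulSemiringAction (Multiplicative ℕ) D]
    (hX : ∀ a : D, SkewPolynomial.φ a = σ a) :
    Module.Free (Subring.center (SkewPolynomial D)) (SkewPolynomial D) ∧
    Module.Finite (Subring.center (SkewPolynomial D)) (SkewPolynomial D) ∧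
    ∀ f : SkewPolynomial D,
      (∃ b : SkewPolynomial D, IsBoundOf b f) ∧
      ∀ b : SkewPolynomial D, IsBoundOf b f →
        (f ≠ 0 → b ≠ 0) ∧
        b.deg ≤
          ((√(Module.finrank (Subring.center (SkewPolynomial D)) (SkewPolynomial D) : ℝ) : ℝ) :
            EReal) * f.deg := by
  obtain ⟨ν, hν, u, hu, h⟩ := hσ
  obtain ⟨F, hFD, hF⟩ := exists_field_finite_algebraMap_range_eq hD σ hν hu h
  have hφσ : ⇑(SkewPolynomial.φ : D →+* D) = σ := funext hX
  have hiter : ∀ (n : ℕ) (c : F), σ^[n] ((c : Subring.center D) : D) = (c : Subring.center D) :=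
    fun n c => Function.iterate_fixed ((hF c).1 c.2) n
  have : SMulCommClass (Multiplicative ℕ) F D := ⟨fun n c d => by
    have key : ∀ x : D, n • x = σ^[Multiplicative.toAdd n] x := fun x => by
      rw [← hφσ, SkewPolynomial.φ_iterate_apply]
      rfl
    have hsmul : ∀ x : D, c • x = ((c : Subring.center D) : D) * x := fun _ => rfl
    rw [key, key, hsmul, hsmul, iterate_map_mul, hiter]⟩
  have hsurj : Function.Surjective (SkewPolynomial.φ : D →+* D) := hφσ ▸ σ.surjective
  obtain ⟨hfree, hfinite, hmain⟩ :=
    SkewPolynomial.free_finite_center_and_exists_mem_center (F := F) (D := D)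
      (fun a ha ha' => ⟨⟨⟨a, Subring.mem_center_iff.2 ha⟩, (hF _).2 ((hX a).symm.trans ha')⟩, rfl⟩)
      (SkewPolynomial.exists_monomial_mem_center hsurj hν hu (by rwa [hφσ]))
  refine ⟨hfree, hfinite, fun f => ⟨SkewPolynomial.exists_isBoundOf F f, fun b hb => ?_⟩⟩
  by_cases hf : f = 0
  · have hb0 : b = 0 := by
      have := hb.isGreatest.1.2 (Ideal.mem_span_singleton_self b)
      simpa [hf] using this
    refine ⟨fun h => absurd hf h, ?_⟩
    -- The left side is `⊥`, so the product with `⊥` on the right need not be evaluated.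
    rw [hb0, SkewPolynomial.deg_zero]
    exact bot_le
  · obtain ⟨z, hz, hz0, hzf, hdeg⟩ := hmain f hf
    obtain ⟨a, ha⟩ := Ideal.mem_span_singleton'.1 (hb.mem_span_of_mem_center hz hzf)
    have hab : a ≠ 0 ∧ b ≠ 0 := by
      rw [← mul_ne_zero_iff, ha]
      exact hz0
    refine ⟨fun _ => hab.2, ?_⟩
    rw [SkewPolynomial.deg_eq_natDegree hf, SkewPolynomial.deg_eq_natDegree hab.2]
    have hle : b.natDegree ≤ z.natDegree := by
      rw [← ha, SkewPolynomial.natDegree_mul hab.1 hab.2]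
      exact Nat.le_add_left _ _
    have hreal : (b.natDegree : ℝ) ≤
        √(Module.finrank (Subring.center (SkewPolynomial D)) (SkewPolynomial D) : ℝ) *
          f.natDegree := by
      rw [← Real.sqrt_sq (Nat.cast_nonneg (α := ℝ) f.natDegree),
        ← Real.sqrt_mul (Nat.cast_nonneg _)]
      refine Real.le_sqrt_of_sq_le ?_
      exact_mod_cast (Nat.pow_le_pow_left hle 2).trans hdeg
    exact_mod_cast hreal
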